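/- Let $B_2$ be the commutative ring (with unit, over $\mathbb Z$) generated by $a,a',b,b'$ and $v_n$ ($n\ge 1$), with relations $$a'b=ab'=ab,\quad aa=aa',\quad bb=bb',\quad (1-a)a=(1-b)b,$$ $$(1-a)v_n=bv_{n+1}\ (n\ge 1),\qquad v_n=(a'+b')v_{n-1}\ (n\ge 2).$$ At a crossing of an unoriented link diagram in the plane, let $H$ denote the diagram, turned locally so that the over-strand of the crossing is horizontal, and let $I$ and $II$ denote the two diagrams obtained from it by smoothing the crossing: in $I$ the crossing is replaced by two arcs lying in the first and third quadrants, in $II$ by two arcs lying in the second and fourth quadrants. Theorem. There is a map $f$ from unoriented link diagrams to $B_2$ with the following properties. (0) $f$ is a link invariant: $f(D)=f(D')$ whenever the diagrams $D$ and $D'$ are related by planar isotopies and Reidemeister moves. (1) If the two strands at a crossing belong to the same link component, then $f(H)=a\,f(I)+b\,f(II)$. (2) If the two strands at a crossing belong to different link components, then $f(H)=a'f(I)+b'f(II)$. (3) If $D$ is a diagram of the trivial link with $n\ge 1$ components, then $f(D)=v_n$. Moreover, for every commutative ring $R$ and every ring homomorphism $\varphi:B_2\to R$, the map $\varphi\circ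 f$ is a link invariant with values in $R$ that satisfies (1), (2) and (3) with $a,a',b,b',v_n$ replaced by their images under $\varphi$. -/

import Mathlib

/-!
Unoriented link diagrams in the plane, in sliced (Morse) form.  A diagram is read from bottom to
top as a finite list of elementary layers; between two consecutive layers it is a row of
vertical strands, numbered 0, 1, 2, … from the left.  Planar isotopies and Reidemeister moves are
generated by local changes of this list.
-/

namespace SkeinLink

/-- Which of the two strands of a crossing is the over-strand: the `rising` one (from lower left
to upper right) or the `falling` one (from upper left to lower right). -/
inductive OverStrand where
  | rising
  | falling

/-- The crossing seen in a mirror in the projection plane. -/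
def OverStrand.flip : OverStrand → OverStrand
  | rising => falling
  | falling => rising

/-- An elementary piece of a diagram: a local minimum (`cup`), a local maximum (`cap`), or a
crossing of two adjacent strands. -/
inductive Piece where
  | cup
  | cap
  | cross (s : OverStrand)

/-- Number of strands entering a piece from below. -/
def Piece.inputs : Piece → ℕ
  | cup => 0
  | cap => 2
  | cross _ => 2

/-- Number of strands leaving a piece at the top. -/
def Piece.outputs : Piece → ℕ
  | cup => 2
  | cap => 0
  | cross _ => 2

/-- A layer: one elementary piece, with `pos` vertical strands to its left, and vertical strands
to its right. -/
structure Layer where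
  piece : Piece
  pos : ℕ

/-- The number of strands above a layer with `n` strands below it (`none` if it does not fit). -/
def Layer.apply (l : Layer) (n : ℕ) : Option ℕ :=
  if l.pos + l.piece.inputs ≤ n then some (n - l.piece.inputs + l.piece.outputs) else none

/-- The number of strands above a stack of layers (listed from bottom to top) with `n` strands
below it (`none` if the layers do not fit together). -/
def width : List Layer → ℕ → Option ℕ
  | [], n => some n
  | l :: w, n => (l.apply n).bind (width w)

theorem width_append (u w : List Layer) (n : ℕ) :
    width (u ++ w) n = (width u n).bind (width w) := by
  induction u generalizing n with
  | nil => rfl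
  | cons l u ih =>
    simp only [List.cons_append, width]
    cases l.apply n with
    | none => rfl
    | some m => simp [ih]

/-- An unoriented link diagram: a stack of layers that fit together, with no strand at the bottom
and none at the top. -/
structure LinkDiagram where
  word : List Layer
  closed : width word 0 = some 0

/-! ### Components -/

/-- The pieces of strand in a stack of layers.  The point `(k, j)` is the point of the `j`-th strand
at the level just above the first `k` layers. -/
inductive Arc (w : List Layer) : ℕ × ℕ → ℕ × ℕ → Prop
  | left {k j : ℕ} {l : Layer} : w[k]? = some l → j < l.pos → Arc w (k, j) (k + 1, j)
  | right {k : ℕ} {l : Layer} (d : ℕ) : w[k]? = some l →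
      Arc w (k, l.pos + l.piece.inputs + d) (k + 1, l.pos + l.piece.outputs + d)
  | cup {k i : ℕ} : w[k]? = some ⟨.cup, i⟩ → Arc w (k + 1, i) (k + 1, i + 1)
  | cap {k i : ℕ} : w[k]? = some ⟨.cap, i⟩ → Arc w (k, i) (k, i + 1)
  | rising {k i : ℕ} {s : OverStrand} : w[k]? = some ⟨.cross s, i⟩ → Arc w (k, i) (k + 1, i + 1)
  | falling {k i : ℕ} {s : OverStrand} : w[k]? = some ⟨.cross s, i⟩ → Arc w (k, i + 1) (k + 1, i)

/-- Two points lie on the same link component: they are joined by a chain of arcs. -/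
def Connected (w : List Layer) : ℕ × ℕ → ℕ × ℕ → Prop :=
  Relation.EqvGen (Arc w)

/-! ### Crossings and their smoothings -/

/-- A crossing of a diagram, given with the layers below it and the layers above it. -/
structure LinkDiagram.Crossing (D : LinkDiagram) where
  below : List Layer
  overStrand : OverStrand
  pos : ℕ
  above : List Layer
  word_eq : D.word = below ++ ⟨.cross overStrand, pos⟩ :: above

namespace LinkDiagram.Crossing

variable {D : LinkDiagram} (c : D.Crossing)

/-- The two strands at the crossing belong to the same link component. -/
def SameComponent : Prop :=
  Connected D.word (c.below.length, c.pos) (c.below.length, c.pos + 1)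

theorem closed_vertical : width (c.below ++ c.above) 0 = some 0 := by
  have h := D.closed
  rw [c.word_eq, width_append] at h
  rw [width_append]
  cases hb : width c.below 0 with
  | none => simp [hb] at h
  | some n =>
    simp only [hb, Option.bind_some, width, Layer.apply, Piece.inputs, Piece.outputs] at h ⊢
    by_cases hn : c.pos + 2 ≤ n
    · have e : n - 2 + 2 = n := by omega
      simpa [hn, e] using h
    · simp [hn] at h

theorem closed_horizontal :
    width (c.below ++ ⟨.cap, c.pos⟩ :: ⟨.cup, c.pos⟩ :: c.above) 0 = some 0 := by
  have h := D.closed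
  rw [c.word_eq, width_append] at h
  rw [width_append]
  cases hb : width c.below 0 with
  | none => simp [hb] at h
  | some n =>
    simp only [hb, Option.bind_some, width, Layer.apply, Piece.inputs, Piece.outputs] at h ⊢
    by_cases hn : c.pos + 2 ≤ n
    · have e : c.pos ≤ n - 2 := by omega
      simpa [hn, e] using h
    · simp [hn] at h

/-- The crossing is replaced by two vertical strands. -/
def smoothVertical : LinkDiagram :=
  ⟨c.below ++ c.above, c.closed_vertical⟩

/-- The crossing is replaced by a cap with a cup above it. -/
def smoothHorizontal : LinkDiagram :=
  ⟨c.below ++ ⟨.cap, c.pos⟩ :: ⟨.cup, c.pos⟩ :: c.above, c.closed_horizontal⟩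

/-- The smoothing `I`.  When the crossing is turned so that its over-strand is horizontal
(the pattern `H`), the two arcs of `I` lie in the first and third quadrants: one joins the right
end to the upper end, the other joins the left end to the lower end. -/
def smoothI : LinkDiagram :=
  match c.overStrand with
  | .rising => c.smoothHorizontal
  | .falling => c.smoothVertical

/-- The smoothing `II`, with its two arcs in the second and fourth quadrants. -/
def smoothII : LinkDiagram :=
  match c.overStrand with
  | .rising => c.smoothVertical
  | .falling => c.smoothHorizontal

end LinkDiagram.Crossing

/-! ### Planar isotopies and Reidemeister moves -/

/-- The local moves, as pairs of stacks of layers. -/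
inductive LocalMove : List Layer → List Layer → Prop
  /-- Planar isotopy: two pieces that are side by side change their heights. -/
  | commute (p q : Piece) (i d : ℕ) :
      LocalMove [⟨p, i⟩, ⟨q, i + p.outputs + d⟩] [⟨q, i + p.inputs + d⟩, ⟨p, i⟩]
  /-- Planar isotopy: a zigzag in a strand is straightened. -/
  | zigzagLeft (i : ℕ) : LocalMove [⟨.cup, i⟩, ⟨.cap, i + 1⟩] []
  | zigzagRight (i : ℕ) : LocalMove [⟨.cup, i + 1⟩, ⟨.cap, i⟩] []
  /-- Planar isotopy: a crossing slides through a local minimum. -/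
  | slideCup (s : OverStrand) (i : ℕ) :
      LocalMove [⟨.cup, i⟩, ⟨.cross s, i + 1⟩] [⟨.cup, i + 1⟩, ⟨.cross s.flip, i⟩]
  /-- Planar isotopy: a crossing slides through a local maximum. -/
  | slideCap (s : OverStrand) (i : ℕ) :
      LocalMove [⟨.cross s, i + 1⟩, ⟨.cap, i⟩] [⟨.cross s.flip, i⟩, ⟨.cap, i + 1⟩]
  /-- The first Reidemeister move: a curl to the right or to the left of a strand. -/
  | reidemeisterOneRight (s : OverStrand) (i : ℕ) :
      LocalMove [⟨.cup, i + 1⟩, ⟨.cross s, i⟩, ⟨.cap, i + 1⟩] []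
  | reidemeisterOneLeft (s : OverStrand) (i : ℕ) :
      LocalMove [⟨.cup, i⟩, ⟨.cross s, i + 1⟩, ⟨.cap, i⟩] []
  /-- The second Reidemeister move. -/
  | reidemeisterTwo (s : OverStrand) (i : ℕ) :
      LocalMove [⟨.cross s, i⟩, ⟨.cross s.flip, i⟩] []
  /-- The third Reidemeister move.  The condition says that the three strands lie at three
  different heights above the plane. -/
  | reidemeisterThree (s t r : OverStrand) (h : s = t ∨ t = r) (i : ℕ) :
      LocalMove [⟨.cross s, i⟩, ⟨.cross t, i + 1⟩, ⟨.cross r, i⟩]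
        [⟨.cross r, i + 1⟩, ⟨.cross t, i⟩, ⟨.cross s, i + 1⟩]

/-- Two diagrams differ by a single planar isotopy or Reidemeister move. -/
def Move (D E : LinkDiagram) : Prop :=
  ∃ u x y w : List Layer, LocalMove x y ∧ D.word = u ++ x ++ w ∧ E.word = u ++ y ++ w

/-- Two diagrams represent the same link: they are related by a finite sequence of planar
isotopies and Reidemeister moves. -/
def SameLink : LinkDiagram → LinkDiagram → Prop :=
  Relation.EqvGen Move

/-- `n` disjoint circles without crossings. -/
def circles : ℕ → LinkDiagram
  | 0 => ⟨[], rfl⟩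
  | n + 1 => ⟨⟨.cup, 0⟩ :: ⟨.cap, 0⟩ :: (circles n).word, (circles n).closed⟩

/-- A diagram of the trivial link with `n` components. -/
def IsTrivial (n : ℕ) (D : LinkDiagram) : Prop :=
  SameLink D (circles n)

/-! ### Invariants with the skein relations -/

/-- A map from link diagrams to a commutative ring is a link invariant, satisfies the skein relation
`H = a I + b II` at a crossing of a component with itself and `H = a' I + b' II` at a crossing of
two different components, and has the value `v n` on the trivial link with `n` components. -/
structure IsSkeinInvariant {R : Type*} [CommRing R] (a a' b b' : R) (v : ℕ+ → R)
    (f : LinkDiagram → R) : Prop where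
  invariant : ∀ D E : LinkDiagram, SameLink D E → f D = f E
  skein_same : ∀ (D : LinkDiagram) (c : D.Crossing), c.SameComponent →
    f D = a * f c.smoothI + b * f c.smoothII
  skein_mixed : ∀ (D : LinkDiagram) (c : D.Crossing), ¬ c.SameComponent →
    f D = a' * f c.smoothI + b' * f c.smoothII
  trivial : ∀ (n : ℕ+) (D : LinkDiagram), IsTrivial n D → f D = v n

/-! ### The ring `B₂` -/

/-- The generators of `B₂`; the index of `v n` runs through `n ≥ 1`. -/
inductive Gen where
  | a
  | a'
  | b
  | b'
  | v (n : ℕ+)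

open MvPolynomial in
/-- The relations of `B₂`; the polynomial `p - q` stands for the relation `p = q`. -/
inductive Relator : MvPolynomial Gen ℤ → Prop
  | a'_b : Relator (X .a' * X .b - X .a * X .b)
  | a_b' : Relator (X .a * X .b' - X .a * X .b)
  | a_a : Relator (X .a * X .a - X .a * X .a')
  | b_b : Relator (X .b * X .b - X .b * X .b')
  | a_b : Relator ((1 - X .a) * X .a - (1 - X .b) * X .b)
  | curl (n : ℕ+) : Relator ((1 - X .a) * X (.v n) - X .b * X (.v (n + 1)))
  | split (n : ℕ+) : Relator (X (.v (n + 1)) - (X .a' + X .b') * X (.v n))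

/-- The commutative ring `B₂`, given by generators and relations. -/
abbrev B₂ : Type :=
  MvPolynomial Gen ℤ ⧸ Ideal.span {p | Relator p}

/-- The class of a generator in `B₂`. -/
noncomputable def B₂.gen (g : Gen) : B₂ :=
  Ideal.Quotient.mk _ (MvPolynomial.X g)

end SkeinLink

/-!
The relations of `B₂` force the value of the invariant: it is `v n` on every diagram of a link with
`n ≥ 1` components.

At a crossing of two different components, both smoothings merge the two components, so the skein
relation says `v (n + 1) = a' v n + b' v n`, a relation of `B₂`. At a crossing of a component with
itself, one smoothing splits the component and the other does not, so the skein relation says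
`v n = a v n + b v (n + 1)` or `v n = a v (n + 1) + b v n`, depending on the crossing. The first is
a relation of `B₂`, and the second follows from it, since `(1 - a) a = (1 - b) b` and
`v (n + 1) = (a' + b') v n`. No other choice is possible on diagrams with at least one strand, as the skein relations
reduce every diagram to diagrams without crossings, which represent trivial links.

What has to be proved is how the number of components behaves. A diagram is read from bottom to top,
keeping track of how the part below pairs up the strands at the current level and of the number of
circles closed so far. Each local move leaves both unchanged (`run_localMove`), so the final number
of circles is a link invariant (`SameLink.componentCount_eq`).

Just above a crossing, the diagram and its two smoothings give pairings that agree except on four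
strands, which they match in the three possible ways (`State.Valid.rewiring`), or else the two lower
ends of the crossing are already joined below it, and the claim is immediate. Following these
strands upwards, the first cap that joins two of them closes a circle in exactly one of the three
diagrams, and leaves the same pairing in all of them. Hence one of the three has one component more
than the other two (`Rewiring.trichotomy`). It is the unsmoothed diagram exactly when the strands of
the crossing lie on different components. To compare with connectedness by arcs, connectedness is
expressed by two-colourings constant along all arcs (`connected_iff_coloring`), which can be
transported through the layers one at a time.
-/

namespace SkeinLink

/-! ### Pairings of the strands -/

/-- What the layers below a given level do to the strands at that level, up to isotopy and change of
crossings: `mate j` is the strand at the other end of the arc that ends in strand `j`, and `loops`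
is the number of circles closed so far. Positions to the right of the last strand are their own
mates. -/
@[ext] structure State where
  mate : ℕ → ℕ
  loops : ℕ

/-- The position, above a cup inserted at `i`, of the strand with position `j` below it. -/
def raise (i j : ℕ) : ℕ := if j < i then j else j + 2

/-- The position, above a cap at `i`, of the strand with position `j` below it.  The value is
meaningless for `j = i` and `j = i + 1`, the two strands that end in the cap. -/
def lower (i j : ℕ) : ℕ := if j < i then j else j - 2

/-- The transposition of `i` and `i + 1`. -/
def exchange (i j : ℕ) : ℕ := if j = i then i + 1 else if j = i + 1 then i else j

/-- The effect of a cup at `i`. -/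
def State.addPair (S : State) (i : ℕ) : State where
  mate j := if j = i then i + 1 else if j = i + 1 then i else raise i (S.mate (lower i j))
  loops := S.loops

/-- The effect of a cap at `i`: the mates of `i` and `i + 1` become mates of each other, or, if `i`
and `i + 1` are mates, a circle is closed. -/
def State.joinPair (S : State) (i : ℕ) : State where
  mate j :=
    if S.mate (raise i j) = i then lower i (S.mate (i + 1))
    else if S.mate (raise i j) = i + 1 then lower i (S.mate i)
    else lower i (S.mate (raise i j))
  loops := if S.mate i = i + 1 then S.loops + 1 else S.loops

/-- The effect of a crossing at `i`. -/
def State.exchangePair (S : State) (i : ℕ) : State where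
  mate j := exchange i (S.mate (exchange i j))
  loops := S.loops

/-- The state above a layer, in terms of the state below it. -/
def Layer.act (l : Layer) (S : State) : State :=
  match l.piece with
  | .cup => S.addPair l.pos
  | .cap => S.joinPair l.pos
  | .cross _ => S.exchangePair l.pos

/-- The state above a stack of layers, in terms of the state below it. -/
def run : List Layer → State → State
  | [], S => S
  | l :: w, S => run w (l.act S)

theorem run_append (u w : List Layer) (S : State) : run (u ++ w) S = run w (run u S) := by
  induction u generalizing S with
  | nil => rfl
  | cons l u ih => exact ih _

/-- The state describes `n` strands, matched in pairs. -/
structure State.Valid (n : ℕ) (S : State) : Prop where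
  mate_mate : ∀ j, S.mate (S.mate j) = j
  mate_eq_self : ∀ j, S.mate j = j ↔ n ≤ j

variable {n m i : ℕ} {S : State}

theorem State.Valid.mate_lt (h : S.Valid n) {j : ℕ} (hj : j < n) : S.mate j < n := by
  have := h.mate_mate j
  have := h.mate_eq_self j
  have := h.mate_eq_self (S.mate j)
  grind

theorem State.Valid.addPair (h : S.Valid n) (hi : i ≤ n) : (S.addPair i).Valid (n + 2) := by
  have h1 := h.mate_mate
  have h2 := h.mate_eq_self
  constructor <;> intro j <;> simp only [State.addPair, raise, lower] <;> grind

theorem State.Valid.exchangePair (h : S.Valid n) (hi : i + 2 ≤ n) :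
    (S.exchangePair i).Valid n := by
  have h1 := h.mate_mate
  have h2 := h.mate_eq_self
  constructor <;> intro j <;> simp only [State.exchangePair, exchange] <;> grind

theorem lower_raise (i j : ℕ) : lower i (raise i j) = j := by grind [lower, raise]

theorem raise_lower {i j : ℕ} (h : j ≠ i) (h' : j ≠ i + 1) : raise i (lower i j) = j := by
  grind [lower, raise]

theorem raise_ne (i j : ℕ) : raise i j ≠ i ∧ raise i j ≠ i + 1 := by grind [raise]

/-- The mate of `k` after `i` and `i + 1` are joined, in the numbering of the strands before the
cap. -/
def State.joined (S : State) (i k : ℕ) : ℕ :=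
    if S.mate k = i then S.mate (i + 1)
    else if S.mate k = i + 1 then S.mate i
    else S.mate k

theorem State.joinPair_mate (j : ℕ) :
    (S.joinPair i).mate j = lower i (S.joined i (raise i j)) := by
  simp only [State.joinPair, State.joined]; split_ifs <;> rfl

theorem State.Valid.joined (h : S.Valid (n + 2)) (hi : i ≤ n) {k : ℕ} (hk : k ≠ i)
    (hk' : k ≠ i + 1) :
    S.joined i k ≠ i ∧ S.joined i k ≠ i + 1 ∧ S.joined i (S.joined i k) = k ∧
      (S.joined i k = k ↔ n + 2 ≤ k) := by
  have h1 := h.mate_mate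
  have h2 := h.mate_eq_self
  grind [State.joined]

theorem State.Valid.joinPair (h : S.Valid (n + 2)) (hi : i ≤ n) :
    (S.joinPair i).Valid n := by
  have h2 : ∀ j, n + 2 ≤ raise i j ↔ n ≤ j := by grind [raise]
  constructor <;> intro j <;> simp only [State.joinPair_mate]
  all_goals
    have ⟨a1, a2⟩ := raise_ne i j
    have ⟨b1, b2, b3, b4⟩ := h.joined hi a1 a2
  · rw [raise_lower b1 b2, b3, lower_raise]
  · rw [← h2, ← b4]
    constructor
    · intro h; rw [← raise_lower b1 b2, h]
    · intro h; rw [h, lower_raise]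

/-! ### Invariance under the local moves -/

theorem Layer.apply_eq_some {l : Layer} :
    l.apply n = some m ↔ l.pos + l.piece.inputs ≤ n ∧ m = n - l.piece.inputs + l.piece.outputs := by
  unfold Layer.apply
  split_ifs with h <;> simp [h, eq_comm]

theorem width_cons {l : Layer} {w : List Layer} :
    width (l :: w) n = some m ↔ ∃ k, l.apply n = some k ∧ width w k = some m := by
  simp [width, Option.bind_eq_some_iff]

theorem width_append_eq_some {u w : List Layer} :
    width (u ++ w) n = some m ↔ ∃ k, width u n = some k ∧ width w k = some m := by
  simp [width_append, Option.bind_eq_some_iff]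

theorem State.Valid.act (h : S.Valid n) {l : Layer} (hl : l.apply n = some m) :
    (l.act S).Valid m := by
  obtain ⟨p, i⟩ := l
  obtain ⟨h1, rfl⟩ := Layer.apply_eq_some.1 hl
  cases p with
  | cup => exact h.addPair h1
  | cap =>
    simp only [Piece.inputs, Piece.outputs] at h1 ⊢
    obtain ⟨k, rfl⟩ : ∃ k, n = k + 2 := ⟨n - 2, by omega⟩
    exact h.joinPair (show i ≤ k by omega)
  | cross s =>
    simp only [Piece.inputs, Piece.outputs] at h1 ⊢
    rw [Nat.sub_add_cancel (by omega)]
    exact h.exchangePair h1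

theorem State.Valid.run (h : S.Valid n) {w : List Layer} (hw : width w n = some m) :
    (run w S).Valid m := by
  induction w generalizing n S with
  | nil => cases hw; exact h
  | cons l w ih =>
    obtain ⟨k, hk, hw⟩ := width_cons.1 hw
    exact ih (h.act hk) hw

theorem State.Valid.mate_ne (h : S.Valid n) {j : ℕ} (hj : j < n) : S.mate j ≠ j := by
  rw [Ne, h.mate_eq_self]; omega

/-- Pieces that are side by side act on disjoint sets of strands.  When both are caps, which of them
closes a circle may depend on their order, but the number of circles closed by both does not. -/
theorem run_commute (p q : Piece) (i d : ℕ) (h : S.Valid n)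
    (hw : width [⟨p, i⟩, ⟨q, i + p.outputs + d⟩] n = some m) :
    run [⟨p, i⟩, ⟨q, i + p.outputs + d⟩] S = run [⟨q, i + p.inputs + d⟩, ⟨p, i⟩] S := by
  obtain ⟨k, hk, hw⟩ := width_cons.1 hw
  obtain ⟨k', hk', -⟩ := width_cons.1 hw
  obtain ⟨a1, rfl⟩ := Layer.apply_eq_some.1 hk
  obtain ⟨a2, -⟩ := Layer.apply_eq_some.1 hk'
  have h1 := h.mate_mate
  have h2 : ∀ j, j < n → S.mate j ≠ j := fun j => h.mate_ne
  cases p <;> cases q <;> simp only [Piece.inputs, Piece.outputs] at a1 a2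
  · ext j <;> simp only [run, Layer.act, Piece.inputs, Piece.outputs, State.addPair, raise, lower]
    grind (splits := 20)
  · have b1 := h2 (i + d) (by omega)
    have b2 := h2 (i + d + 1) (by omega)
    ext j <;> simp only [run, Layer.act, Piece.inputs, Piece.outputs, State.addPair,
      State.joinPair, raise, lower] <;> clear a1 a2 h2 h <;> grind (splits := 20)
  · ext j <;> simp only [run, Layer.act, Piece.inputs, Piece.outputs, State.addPair,
      State.exchangePair, exchange, raise, lower]
    grind (splits := 20)
  · have b1 := h2 i (by omega)
    have b2 := h2 (i + 1) (by omega)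
    ext j <;> simp only [run, Layer.act, Piece.inputs, Piece.outputs, State.addPair,
      State.joinPair, raise, lower] <;> clear a1 a2 h2 h <;> grind (splits := 20)
  · have b1 := h2 i (by omega)
    have b2 := h2 (i + 1) (by omega)
    have b3 := h2 (i + 2 + d) (by omega)
    have b4 := h2 (i + 2 + d + 1) (by omega)
    ext j <;> simp only [run, Layer.act, Piece.inputs, Piece.outputs,
      State.joinPair, raise, lower] <;> clear a1 a2 h2 h <;> grind (splits := 20)
  · have b1 := h2 i (by omega)
    have b2 := h2 (i + 1) (by omega)
    ext j <;> simp only [run, Layer.act, Piece.inputs, Piece.outputs, State.exchangePair, exchange,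
      State.joinPair, raise, lower] <;> clear a1 a2 h2 h <;> grind (splits := 20)
  · ext j <;> simp only [run, Layer.act, Piece.inputs, Piece.outputs, State.addPair,
      State.exchangePair, exchange, raise, lower]
    grind (splits := 20)
  · have b1 := h2 (i + 2 + d) (by omega)
    have b2 := h2 (i + 2 + d + 1) (by omega)
    ext j <;> simp only [run, Layer.act, Piece.inputs, Piece.outputs, State.exchangePair, exchange,
      State.joinPair, raise, lower] <;> clear a1 a2 h2 h <;> grind (splits := 20)
  · ext j <;> simp only [run, Layer.act, Piece.inputs, Piece.outputs,
      State.exchangePair, exchange]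
    grind (splits := 20)

/-- Each local move leaves the induced pairing, and the number of circles closed, unchanged. -/
theorem run_localMove {x y : List Layer} (hxy : LocalMove x y) (h : S.Valid n)
    (hx : width x n = some m) (hy : width y n = some m) : run x S = run y S := by
  have h1 := h.mate_mate
  have h2 := h.mate_eq_self
  cases hxy with
  | commute p q i d => exact run_commute p q i d h hx
  | zigzagLeft i | zigzagRight i =>
    simp [width, Option.bind_eq_some_iff, Layer.apply_eq_some, Piece.inputs, Piece.outputs] at hx
    ext j <;> simp only [run, Layer.act, State.addPair, State.joinPair, raise, lower] <;> grind
  | slideCup s i =>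
    ext j <;> simp only [run, Layer.act, State.addPair, State.exchangePair, exchange, raise,
      lower]
    clear hx hy h1 h2 h
    grind (splits := 20)
  | slideCap s i =>
    simp [width, Option.bind_eq_some_iff, Layer.apply_eq_some, Piece.inputs, Piece.outputs] at hx
    ext j <;> simp only [run, Layer.act, State.joinPair, State.exchangePair, exchange, raise,
      lower] <;> grind (splits := 20)
  | reidemeisterOneRight s i | reidemeisterOneLeft s i =>
    simp [width, Option.bind_eq_some_iff, Layer.apply_eq_some, Piece.inputs, Piece.outputs] at hx
    ext j <;> simp only [run, Layer.act, State.addPair, State.joinPair, State.exchangePair,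
      exchange, raise, lower] <;> grind (splits := 20)
  | reidemeisterTwo s i =>
    ext j <;> simp only [run, Layer.act, State.exchangePair, exchange]
    grind
  | reidemeisterThree s t r _ i =>
    ext j <;> simp only [run, Layer.act, State.exchangePair, exchange]
    grind

theorem LocalMove.width_eq {x y : List Layer} (hxy : LocalMove x y) {m' : ℕ}
    (hx : width x n = some m) (hy : width y n = some m') : m = m' := by
  cases hxy <;>
  simp [width, Option.bind_eq_some_iff, Layer.apply_eq_some, Piece.inputs, Piece.outputs]
    at hx hy <;>
  omega

/-- The state below a diagram: no strands and no circles. -/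
def State.initial : State := ⟨id, 0⟩

theorem State.valid_initial : State.initial.Valid 0 := ⟨fun _ => rfl, fun j => by simp [initial]⟩

/-- The number of components of the link, counted as the circles closed while the diagram is read
from bottom to top. -/
def LinkDiagram.componentCount (D : LinkDiagram) : ℕ := (run D.word .initial).loops

theorem Move.componentCount_eq {D E : LinkDiagram} (h : Move D E) :
    D.componentCount = E.componentCount := by
  obtain ⟨u, x, y, w, hxy, hD, hE⟩ := h
  have h1 := D.closed
  have h2 := E.closed
  simp only [LinkDiagram.componentCount, hD, hE, run_append] at h1 h2 ⊢
  obtain ⟨k, hk, -⟩ := width_append_eq_some.1 h1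
  obtain ⟨j, hj, hx⟩ := width_append_eq_some.1 hk
  obtain ⟨k', hk', -⟩ := width_append_eq_some.1 h2
  obtain ⟨j', hj', hy⟩ := width_append_eq_some.1 hk'
  obtain rfl : j = j' := by simpa [hj] using hj'
  obtain rfl := hxy.width_eq hx hy
  rw [run_localMove hxy (State.valid_initial.run hj) hx hy]

theorem SameLink.componentCount_eq {D E : LinkDiagram} (h : SameLink D E) :
    D.componentCount = E.componentCount := by
  induction h with
  | rel _ _ h => exact Move.componentCount_eq h
  | refl => rfl
  | symm _ _ _ ih => exact ih.symm
  | trans _ _ _ _ _ ih₁ ih₂ => exact ih₁.trans ih₂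

/-! ### Counting circles -/

theorem State.joinPair_addPair (h : S.Valid n) :
    (S.addPair i).joinPair i = ⟨S.mate, S.loops + 1⟩ := by
  have h1 := h.mate_mate
  ext j <;> simp only [State.addPair, State.joinPair, raise, lower] <;> grind

theorem run_addLoop (w : List Layer) (S : State) :
    run w ⟨S.mate, S.loops + 1⟩ = ⟨(run w S).mate, (run w S).loops + 1⟩ := by
  induction w generalizing S with
  | nil => rfl
  | cons l w ih =>
    rw [run, run, ← ih]
    congr 1
    obtain ⟨p, i⟩ := l
    cases p <;> simp [Layer.act, State.addPair, State.joinPair, State.exchangePair]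
    split_ifs <;> rfl

theorem componentCount_circles (n : ℕ) : (circles n).componentCount = n := by
  induction n with
  | zero => rfl
  | succ n ih =>
    have : run (circles (n + 1)).word .initial =
        run (circles n).word ((State.initial.addPair 0).joinPair 0) := rfl
    rw [LinkDiagram.componentCount, this, State.joinPair_addPair State.valid_initial,
      run_addLoop]
    exact congrArg (· + 1) ih

theorem loops_le_run (w : List Layer) (S : State) : S.loops ≤ (run w S).loops := by
  induction w generalizing S with
  | nil => rfl
  | cons l w ih =>
    refine le_trans ?_ (ih _)
    obtain ⟨p, i⟩ := l
    cases p <;> simp [Layer.act, State.addPair, State.joinPair, State.exchangePair]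
    split_ifs <;> omega

/-- A stack of layers that closes off at least one strand closes at least one circle. -/
theorem loops_lt_run {w : List Layer} (h : S.Valid n) (hw : width w n = some 0) (hn : 0 < n) :
    S.loops < (run w S).loops := by
  induction w generalizing n S with
  | nil => cases hw; omega
  | cons l w ih =>
    obtain ⟨k, hk, hw⟩ := width_cons.1 hw
    rcases Nat.eq_zero_or_pos k with rfl | hk0
    · refine lt_of_lt_of_le ?_ (loops_le_run w _)
      obtain ⟨p, i⟩ := l
      obtain ⟨h1, h2⟩ := Layer.apply_eq_some.1 hk
      cases p <;> simp only [Piece.inputs, Piece.outputs] at h1 h2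
      case cap =>
        have h3 := h.mate_lt (j := i) (by omega)
        have h4 := h.mate_ne (j := i) (by omega)
        have : S.mate i = i + 1 := by omega
        simp [Layer.act, State.joinPair, this]
      all_goals omega
    · refine lt_of_le_of_lt ?_ (ih (h.act hk) hw hk0)
      exact loops_le_run [l] S

/-! ### Colourings and connectedness -/

/-- A two-colouring of the strands gives the same colour to the two ends of each arc. -/
def State.Respects (S : State) (χ : ℕ → Prop) : Prop := ∀ j, χ (S.mate j) ↔ χ j

/-- Two-colourings `χ` of the strands below a layer and `χ'` of the strands above it fit together
along the arcs of the layer. -/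
def Layer.Compatible (l : Layer) (χ χ' : ℕ → Prop) : Prop :=
  match l.piece with
  | .cup => (χ' l.pos ↔ χ' (l.pos + 1)) ∧ ∀ j, χ' (raise l.pos j) ↔ χ j
  | .cap => (χ l.pos ↔ χ (l.pos + 1)) ∧ ∀ j, χ (raise l.pos j) ↔ χ' j
  | .cross _ => ∀ j, χ' (exchange l.pos j) ↔ χ j

theorem exchange_exchange (i j : ℕ) : exchange i (exchange i j) = j := by grind [exchange]

theorem State.Respects.act (hS : S.Valid n) {l : Layer} (hl : l.apply n = some m)
    {χ χ' : ℕ → Prop} (h : S.Respects χ) (hc : l.Compatible χ χ') : (l.act S).Respects χ' := by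
  obtain ⟨p, i⟩ := l
  obtain ⟨hi, -⟩ := Layer.apply_eq_some.1 hl
  cases p <;> simp only [Layer.Compatible, Layer.act, State.Respects] at hc h ⊢ <;> intro j
  · simp only [State.addPair]
    have := h (lower i j)
    have h3 : j ≠ i → j ≠ i + 1 → raise i (lower i j) = j := raise_lower
    grind
  · obtain ⟨h1, h2⟩ := hc
    simp only [Piece.inputs] at hi
    obtain ⟨k, rfl⟩ : ∃ k, n = k + 2 := ⟨n - 2, by omega⟩
    obtain ⟨a, b⟩ := raise_ne i j
    obtain ⟨a', b', -⟩ := hS.joined (by omega) a b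
    rw [State.joinPair_mate, ← h2, ← h2, raise_lower a' b']
    grind [State.joined]
  · simp only [State.exchangePair]
    have := hc (exchange i j)
    rw [exchange_exchange] at this
    rw [hc, h, this]

/-- A colouring of the arcs above a layer pulls back to the arcs below it.  A circle closed by the
layer may be given any colour. -/
theorem State.Respects.exists_compatible (hS : S.Valid n) {l : Layer} (hl : l.apply n = some m)
    {χ' : ℕ → Prop} (h : (l.act S).Respects χ') : ∃ χ, S.Respects χ ∧ l.Compatible χ χ' := by
  have e1 := hS.mate_mate
  have e2 := hS.mate_eq_self
  obtain ⟨p, i⟩ := l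
  obtain ⟨h1, -⟩ := Layer.apply_eq_some.1 hl
  cases p <;> simp only [Layer.Compatible, Layer.act, State.Respects, Piece.inputs] at h h1 ⊢
  · refine ⟨fun j => χ' (raise i j), fun j => ?_, ?_, fun j => Iff.rfl⟩
    · have := h (raise i j)
      obtain ⟨a, b⟩ := raise_ne i j
      simpa [State.addPair, a, b, lower_raise] using this
    · have := h i
      simpa [State.addPair, iff_comm] using this
  · have h4 (j) : χ' (lower i (S.joined i (raise i j))) ↔ χ' j := by
      rw [← State.joinPair_mate]; exact h j
    let ψ (j : ℕ) : Prop := χ' (lower i j)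
    -- `i` and `i + 1` get the colour of the mate of `i`; if they are mates of each other, `ψ` takes
    -- a meaningless value there, and any colour will do.
    refine ⟨fun j => if j = i ∨ j = i + 1 then ψ (S.mate i) else ψ j, fun j => ?_, ?_, fun j => ?_⟩
    · have h5 (k) (a : k ≠ i) (b : k ≠ i + 1) : ψ (S.joined i k) ↔ ψ k := by
        have := h4 (lower i k); rwa [raise_lower a b] at this
      grind [State.joined]
    · simp
    · obtain ⟨a, b⟩ := raise_ne i j
      simp [a, b, ψ, lower_raise]
  · refine ⟨fun j => χ' (exchange i j), fun j => ?_, fun j => Iff.rfl⟩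
    have := h (exchange i j)
    simpa [State.exchangePair, exchange_exchange] using this

/-- `g k` is a two-colouring of the strands above the first `k` layers, such that `g` is constant
along the arcs of the whole stack. -/
def IsColoring (w : List Layer) (g : ℕ → ℕ → Prop) : Prop :=
  ∀ (k : ℕ) (l : Layer), w[k]? = some l → l.Compatible (g k) (g (k + 1))

theorem isColoring_cons {l : Layer} {w : List Layer} {g : ℕ → ℕ → Prop} :
    IsColoring (l :: w) g ↔ l.Compatible (g 0) (g 1) ∧ IsColoring w (fun k => g (k + 1)) := by
  constructor
  · intro h
    exact ⟨h 0 l rfl, fun k l' hk => h (k + 1) l' (by simpa using hk)⟩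
  · rintro ⟨h, h'⟩ (_ | k) l' hk
    · cases hk; exact h
    · exact h' k l' (by simpa using hk)

theorem IsColoring.cons {l : Layer} {w : List Layer} {g : ℕ → ℕ → Prop} (h : IsColoring w g)
    {χ : ℕ → Prop} (hc : l.Compatible χ (g 0)) :
    IsColoring (l :: w) (fun k => k.casesOn χ g) :=
  isColoring_cons.2 ⟨hc, h⟩

theorem IsColoring.respects_run {u w : List Layer} {g : ℕ → ℕ → Prop}
    (h : IsColoring (u ++ w) g) (hS : S.Valid n) (hu : width u n = some m)
    (hr : S.Respects (g 0)) : (run u S).Respects (g u.length) := by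
  induction u generalizing S g n with
  | nil => exact hr
  | cons l u ih =>
    obtain ⟨k, hk, hu⟩ := width_cons.1 hu
    obtain ⟨h1, h2⟩ := isColoring_cons.1 h
    exact ih h2 (hS.act hk) hu (hr.act hS hk h1)

theorem IsColoring.of_append {u w : List Layer} {g : ℕ → ℕ → Prop} (h : IsColoring (u ++ w) g) :
    IsColoring w (fun k => g (u.length + k)) := by
  intro k l hk
  refine h (u.length + k) l ?_
  rwa [List.getElem?_append_right (Nat.le_add_right _ _), Nat.add_sub_cancel_left]

theorem IsColoring.exists_append {u w : List Layer} {g : ℕ → ℕ → Prop} (h : IsColoring w g)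
    (hS : S.Valid n) (hu : width u n = some m) (hr : (run u S).Respects (g 0)) :
    ∃ g', IsColoring (u ++ w) g' ∧ S.Respects (g' 0) ∧ ∀ k, g' (u.length + k) = g k := by
  induction u generalizing S n with
  | nil => exact ⟨g, h, hr, fun k => by simp⟩
  | cons l u ih =>
    obtain ⟨k, hk, hu⟩ := width_cons.1 hu
    obtain ⟨g', h1, h2, h3⟩ := ih (hS.act hk) hu hr
    obtain ⟨χ, h4, h5⟩ := State.Respects.exists_compatible hS hk h2
    refine ⟨_, h1.cons h5, h4, fun k => ?_⟩
    rw [← h3 k, List.length_cons, Nat.add_right_comm]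

theorem isColoring_iff_arc {w : List Layer} {g : ℕ → ℕ → Prop} :
    IsColoring w g ↔ ∀ x y, Arc w x y → (g x.1 x.2 ↔ g y.1 y.2) := by
  constructor
  · intro h x y hxy
    cases hxy with
    | @left k j l hk hj =>
      have := h k _ hk
      obtain ⟨p, i⟩ := l
      cases p <;> simp only [Layer.Compatible] at this hj
      · have := this.2 j; grind [raise]
      · have := this.2 j; grind [raise]
      · have := this j; grind [exchange]
    | @right k l d hk =>
      have := h k _ hk
      obtain ⟨p, i⟩ := l
      cases p <;> simp only [Layer.Compatible, Piece.inputs, Piece.outputs] at this ⊢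
      · have := this.2 (i + d); grind [raise]
      · have := this.2 (i + d); grind [raise]
      · have := this (i + 2 + d); grind [exchange]
    | cup hk => exact (h _ _ hk).1
    | cap hk => exact (h _ _ hk).1
    | @rising k i s hk =>
      have : ∀ j, _ := h _ _ hk
      have := this i
      grind [exchange]
    | @falling k i s hk =>
      have : ∀ j, _ := h _ _ hk
      have := this (i + 1)
      grind [exchange]
  · rintro h k ⟨p, i⟩ hk
    have hl (j : ℕ) (hj : j < i) : g k j ↔ g (k + 1) j := h _ _ (Arc.left hk hj)
    have hr (d : ℕ) := h _ _ (Arc.right d hk)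
    cases p <;> simp only [Layer.Compatible, Piece.inputs, Piece.outputs] at hr ⊢
    · refine ⟨h _ _ (Arc.cup hk), fun j => ?_⟩
      have := hl j
      have := hr (j - i)
      grind [raise]
    · refine ⟨h _ _ (Arc.cap hk), fun j => ?_⟩
      have := hl j
      have := hr (j - i)
      grind [raise]
    · intro j
      have := hl j
      have := hr (j - i - 2)
      have : g k i ↔ g (k + 1) (i + 1) := h _ _ (Arc.rising hk)
      have : g k (i + 1) ↔ g (k + 1) i := h _ _ (Arc.falling hk)
      grind [exchange]

/-- Two points are connected exactly when no colouring separates them: the set of points connected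
to a given one is itself a colouring. -/
theorem connected_iff_coloring {w : List Layer} {x y : ℕ × ℕ} :
    Connected w x y ↔ ∀ g, IsColoring w g → (g x.1 x.2 ↔ g y.1 y.2) := by
  constructor
  · intro h g hg
    induction h with
    | rel _ _ h => exact isColoring_iff_arc.1 hg _ _ h
    | refl => rfl
    | symm _ _ _ ih => exact ih.symm
    | trans _ _ _ _ _ ih₁ ih₂ => exact ih₁.trans ih₂
  · intro h
    refine (h (fun k j => Connected w x (k, j)) ?_).1 (.refl x)
    rw [isColoring_iff_arc]
    exact fun y z hyz => ⟨fun h => h.trans _ _ _ (.rel _ _ hyz),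
      fun h => h.trans _ _ _ (.symm _ _ (.rel _ _ hyz))⟩

/-! ### Rewiring four strands -/

/-- Three states that agree outside four strands `p`, `q`, `r`, `s` and match these four in the
three possible ways: `pq | rs`, `pr | qs` and `ps | qr`. -/
structure Rewiring (n : ℕ) (S₁ S₂ S₃ : State) (p q r s : ℕ) : Prop where
  nodup : [p, q, r, s].Nodup
  valid₁ : S₁.Valid n
  valid₂ : S₂.Valid n
  valid₃ : S₃.Valid n
  loops₂ : S₂.loops = S₁.loops
  loops₃ : S₃.loops = S₁.loops
  mate₁ : S₁.mate p = q ∧ S₁.mate q = p ∧ S₁.mate r = s ∧ S₁.mate s = r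
  mate₂ : S₂.mate p = r ∧ S₂.mate r = p ∧ S₂.mate q = s ∧ S₂.mate s = q
  mate₃ : S₃.mate p = s ∧ S₃.mate s = p ∧ S₃.mate q = r ∧ S₃.mate r = q
  mate_eq : ∀ j, j ≠ p → j ≠ q → j ≠ r → j ≠ s → S₂.mate j = S₁.mate j ∧ S₃.mate j = S₁.mate j

variable {S₁ S₂ S₃ : State} {p q r s : ℕ}

theorem Rewiring.addPair (h : Rewiring n S₁ S₂ S₃ p q r s) (hi : i ≤ n) :
    Rewiring (n + 2) (S₁.addPair i) (S₂.addPair i) (S₃.addPair i)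
      (raise i p) (raise i q) (raise i r) (raise i s) := by
  obtain ⟨hd, v1, v2, v3, l2, l3, m1, m2, m3, he⟩ := h
  have hinj (a b : ℕ) : raise i a = raise i b ↔ a = b :=
    ⟨fun h => by rw [← lower_raise i a, h, lower_raise], fun h => h ▸ rfl⟩
  have hm (S : State) (j : ℕ) : (S.addPair i).mate (raise i j) = raise i (S.mate j) := by
    obtain ⟨a, b⟩ := raise_ne i j
    simp [State.addPair, a, b, lower_raise]
  refine ⟨by simpa [hinj] using hd, v1.addPair hi, v2.addPair hi, v3.addPair hi, l2, l3,
    by simpa [hm, hinj] using m1, by simpa [hm, hinj] using m2, by simpa [hm, hinj] using m3,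
    fun j h1 h2 h3 h4 => ?_⟩
  by_cases hj : j = i ∨ j = i + 1
  · rcases hj with rfl | rfl <;> simp [State.addPair]
  · push Not at hj
    rw [← raise_lower hj.1 hj.2] at h1 h2 h3 h4 ⊢
    simp only [hm, hinj, Ne] at *
    exact he _ h1 h2 h3 h4

theorem Rewiring.exchangePair (h : Rewiring n S₁ S₂ S₃ p q r s) (hi : i + 2 ≤ n) :
    Rewiring n (S₁.exchangePair i) (S₂.exchangePair i) (S₃.exchangePair i)
      (exchange i p) (exchange i q) (exchange i r) (exchange i s) := by
  obtain ⟨hd, v1, v2, v3, l2, l3, m1, m2, m3, he⟩ := h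
  have hinj (a b : ℕ) : exchange i a = exchange i b ↔ a = b :=
    ⟨fun h => by rw [← exchange_exchange i a, h, exchange_exchange], fun h => h ▸ rfl⟩
  have hm (S : State) (j : ℕ) :
      (S.exchangePair i).mate (exchange i j) = exchange i (S.mate j) := by
    simp [State.exchangePair, exchange_exchange]
  refine ⟨by simpa [hinj] using hd, v1.exchangePair hi, v2.exchangePair hi, v3.exchangePair hi,
    l2, l3, by simpa [hm, hinj] using m1, by simpa [hm, hinj] using m2,
    by simpa [hm, hinj] using m3, fun j h1 h2 h3 h4 => ?_⟩
  rw [← exchange_exchange i j] at h1 h2 h3 h4 ⊢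
  simp only [hm, hinj, Ne] at *
  exact he _ h1 h2 h3 h4

/-- The strand that takes over the role of `j` when `i` and `i + 1` are joined: if `j` is one of
these two, the arc at `j` is prolonged to the mate of the other. -/
def State.follow (S : State) (i j : ℕ) : ℕ :=
  if j = i then S.mate (i + 1) else if j = i + 1 then S.mate i else j

/-- A cap that does not join two of the four strands of a rewiring gives a rewiring: it prolongs at
most one of the four arcs, in the same way in all three states. -/
theorem Rewiring.joinPair (h : Rewiring (n + 2) S₁ S₂ S₃ p q r s) (hi : i ≤ n)
    (ha : ¬ (i ∈ [p, q, r, s] ∧ i + 1 ∈ [p, q, r, s])) :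
    Rewiring n (S₁.joinPair i) (S₂.joinPair i) (S₃.joinPair i)
      (lower i (S₁.follow i p)) (lower i (S₁.follow i q))
      (lower i (S₁.follow i r)) (lower i (S₁.follow i s)) := by
  obtain ⟨hd, v1, v2, v3, l2, l3, m1, m2, m3, he⟩ := h
  have e1 := v1.mate_mate
  have f1 (j) : j < n + 2 → S₁.mate j ≠ j := v1.mate_ne
  simp only [List.mem_cons, List.nodup_cons, List.not_mem_nil, or_false] at ha hd
  have hf : ∀ j ∈ [p, q, r, s], S₁.follow i j ≠ i ∧ S₁.follow i j ≠ i + 1 := by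
    have := f1 i (by omega)
    have := f1 (i + 1) (by omega)
    intro j hj
    simp only [List.mem_cons, List.not_mem_nil, or_false] at hj
    grind [State.follow]
  have hfinj (a b : ℕ) (h1 : a ∈ [p, q, r, s]) (h2 : b ∈ [p, q, r, s])
      (hab : S₁.follow i a = S₁.follow i b) : a = b := by
    simp only [List.mem_cons, List.not_mem_nil, or_false] at h1 h2
    have e2 := e1 i
    have e3 := e1 (i + 1)
    clear m2 m3 he e1 f1 hf v1 v2 v3
    unfold State.follow at hab
    grind
  have hinj (a b : ℕ) (ha : a ≠ i ∧ a ≠ i + 1) (hb : b ≠ i ∧ b ≠ i + 1) :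
      lower i a = lower i b ↔ a = b :=
    ⟨fun h => by rw [← raise_lower ha.1 ha.2, h, raise_lower hb.1 hb.2], fun h => h ▸ rfl⟩
  simp only [List.forall_mem_cons] at hf
  obtain ⟨hp, hq, hr, hs, -⟩ := hf
  have hm (S : State) (j : ℕ) (hj : j ≠ i ∧ j ≠ i + 1) :
      (S.joinPair i).mate (lower i j) = lower i (S.joined i j) := by
    rw [State.joinPair_mate, raise_lower hj.1 hj.2]
  refine ⟨?_, v1.joinPair hi, v2.joinPair hi, v3.joinPair hi, ?_, ?_, ?_, ?_, ?_, ?_⟩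
  · simp only [List.mem_cons, List.nodup_cons, List.not_mem_nil, or_false, hinj, hp, hq, hr, hs,
      Ne, not_false_eq_true, and_self]
    simp only [List.mem_cons, List.not_mem_nil, or_false] at hfinj
    grind
  · simp only [State.joinPair]; grind
  · simp only [State.joinPair]; grind
  · rw [hm _ _ hp, hm _ _ hq, hm _ _ hr, hm _ _ hs]
    refine ⟨congrArg _ ?_, congrArg _ ?_, congrArg _ ?_, congrArg _ ?_⟩ <;>
    grind [State.follow, State.joined]
  · rw [hm _ _ hp, hm _ _ hq, hm _ _ hr, hm _ _ hs]
    refine ⟨congrArg _ ?_, congrArg _ ?_, congrArg _ ?_, congrArg _ ?_⟩ <;>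
    grind [State.follow, State.joined]
  · rw [hm _ _ hp, hm _ _ hq, hm _ _ hr, hm _ _ hs]
    refine ⟨congrArg _ ?_, congrArg _ ?_, congrArg _ ?_, congrArg _ ?_⟩ <;>
    grind [State.follow, State.joined]
  · intro j
    rw [← lower_raise i j]
    have hj := raise_ne i j
    generalize raise i j = k at hj
    simp only [hinj _ _ hj, hp, hq, hr, hs, Ne, not_false_eq_true, and_self, hm _ _ hj]
    intro h1 h2 h3 h4
    refine ⟨congrArg _ ?_, congrArg _ ?_⟩ <;> grind [State.follow, State.joined]

/-- The same pairing with one more circle. -/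
def State.addLoop (S : State) : State := ⟨S.mate, S.loops + 1⟩

/-- A cap that joins two of the four strands closes a circle in exactly one of the three states, and
in all three it makes mates of the remaining two. -/
theorem Rewiring.joinPair_of_mate (h : Rewiring (n + 2) S₁ S₂ S₃ p q r s)
    (ha : i ∈ [p, q, r, s]) (hb : S₁.mate i = i + 1) :
    S₁.joinPair i = (S₂.joinPair i).addLoop ∧ S₃.joinPair i = S₂.joinPair i := by
  obtain ⟨hd, v1, v2, v3, l2, l3, m1, m2, m3, he⟩ := h
  have e1 := v1.mate_mate
  simp only [List.mem_cons, List.nodup_cons, List.not_mem_nil, or_false] at ha hd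
  constructor <;> ext j
  · have := raise_ne i j
    simp only [State.joinPair_mate, State.addLoop]
    congr 1
    grind [State.joined]
  · simp only [State.joinPair, State.addLoop]
    grind
  · have := raise_ne i j
    simp only [State.joinPair_mate]
    congr 1
    grind [State.joined]
  · simp only [State.joinPair]
    grind

theorem Rewiring.swap₁₂ (h : Rewiring n S₁ S₂ S₃ p q r s) : Rewiring n S₂ S₁ S₃ p r q s := by
  obtain ⟨hd, v1, v2, v3, l2, l3, m1, m2, m3, he⟩ := h
  refine ⟨?_, v2, v1, v3, l2.symm, l3.trans l2.symm, m2, m1, by tauto, fun j a b c d => ?_⟩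
  · simp only [List.mem_cons, List.nodup_cons, List.not_mem_nil, or_false] at hd ⊢; grind
  · have := he j a c b d; grind

theorem Rewiring.swap₂₃ (h : Rewiring n S₁ S₂ S₃ p q r s) : Rewiring n S₁ S₃ S₂ p q s r := by
  obtain ⟨hd, v1, v2, v3, l2, l3, m1, m2, m3, he⟩ := h
  refine ⟨?_, v1, v3, v2, l3, l2, by tauto, by tauto, by tauto, fun j a b c d => ?_⟩
  · simp only [List.mem_cons, List.nodup_cons, List.not_mem_nil, or_false] at hd ⊢; grind
  · have := he j a b d c; grind

/-- The possible outcomes when the same layers `w` are put on three states that form a rewiring: one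
of the three links has one component more than the other two. It is the first one exactly when a
colouring separates `p` from `r`, that is, when these lie on different components of the first link.
-/
def Trichotomy (w : List Layer) (S₁ S₂ S₃ : State) (p r : ℕ) : Prop :=
  ((run w S₁).loops = (run w S₂).loops + 1 ∧ (run w S₃).loops = (run w S₂).loops ∧
      ∃ g, IsColoring w g ∧ S₁.Respects (g 0) ∧ ¬ (g 0 p ↔ g 0 r)) ∨
    (((run w S₂).loops = (run w S₁).loops + 1 ∧ (run w S₃).loops = (run w S₁).loops ∨
        (run w S₃).loops = (run w S₁).loops + 1 ∧ (run w S₂).loops = (run w S₁).loops) ∧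
      ∀ g, IsColoring w g → S₁.Respects (g 0) → (g 0 p ↔ g 0 r))

theorem Trichotomy.cons {l : Layer} {w : List Layer} {p' r' : ℕ} (v : S₁.Valid n)
    (hl : l.apply n = some m) (h : Trichotomy w (l.act S₁) (l.act S₂) (l.act S₃) p' r')
    (hc : ∀ χ χ', S₁.Respects χ → l.Compatible χ χ' → ((χ p ↔ χ' p') ∧ (χ r ↔ χ' r'))) :
    Trichotomy (l :: w) S₁ S₂ S₃ p r := by
  rcases h with ⟨h1, h2, g, hg, hr, hpr⟩ | ⟨h1, h2⟩
  · obtain ⟨χ, h3, h4⟩ := State.Respects.exists_compatible v hl hr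
    refine .inl ⟨h1, h2, _, hg.cons h4, h3, ?_⟩
    have := hc _ _ h3 h4
    change ¬ (χ p ↔ χ r)
    tauto
  · refine .inr ⟨h1, fun g hg hr => ?_⟩
    obtain ⟨h3, h4⟩ := isColoring_cons.1 hg
    have := hc _ _ hr h3
    have := h2 _ h4 (hr.act v hl h3)
    simp only [Nat.zero_add] at this
    tauto

theorem isColoring_false (w : List Layer) : IsColoring w (fun _ _ => False) := by
  intro k l _
  obtain ⟨p, i⟩ := l
  cases p <;> simp [Layer.Compatible]

theorem loops_run_addLoop (w : List Layer) (S : State) :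
    (run w S.addLoop).loops = (run w S).loops + 1 := by
  rw [State.addLoop, run_addLoop]

/-- The four strands of a rewiring are followed upwards until a cap joins two of them. -/
theorem Rewiring.trichotomy {w : List Layer} (h : Rewiring n S₁ S₂ S₃ p q r s)
    (hw : width w n = some 0) : Trichotomy w S₁ S₂ S₃ p r := by
  induction w generalizing n S₁ S₂ S₃ p q r s with
  | nil =>
    cases hw
    have := h.nodup
    have h1 := (h.valid₁.mate_eq_self p).2 (Nat.zero_le _)
    rw [h.mate₁.1] at h1
    simp [h1] at this
  | cons l w ih =>
    obtain ⟨m, hl, hw'⟩ := width_cons.1 hw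
    obtain ⟨x, i⟩ := l
    obtain ⟨hi, hm⟩ := Layer.apply_eq_some.1 hl
    cases x <;> simp only [Piece.inputs, Piece.outputs] at hi hm
    · subst hm
      exact (ih (h.addPair hi) hw').cons h.valid₁ hl
        fun χ χ' _ hc => ⟨(hc.2 p).symm, (hc.2 r).symm⟩
    · obtain ⟨k, rfl⟩ : ∃ k, n = k + 2 := ⟨n - 2, by omega⟩
      obtain rfl : m = k := hm
      have hi' : i ≤ m := by omega
      by_cases ha : i ∈ [p, q, r, s] ∧ i + 1 ∈ [p, q, r, s]
      · obtain ⟨ha, hb⟩ := ha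
        obtain ⟨hd, v1, v2, v3, l2, l3, m1, m2, m3, he⟩ := id h
        simp only [List.mem_cons, List.nodup_cons, List.not_mem_nil, or_false] at hd hb
        have ha' := ha
        simp only [List.mem_cons, List.not_mem_nil, or_false] at ha'
        have hcases : S₁.mate i = i + 1 ∨ S₂.mate i = i + 1 ∨ S₃.mate i = i + 1 := by
          grind
        have hsame : S₁.mate i ≠ i + 1 → ∀ g, IsColoring (⟨.cap, i⟩ :: w) g →
            S₁.Respects (g 0) → (g 0 p ↔ g 0 r) := by
          intro hne g hg hr
          have h1 := (isColoring_cons.1 hg).1.1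
          have h2 := hr p
          have h3 := hr r
          simp only at h1
          grind
        rcases hcases with hc | hc | hc
        -- The cap closes a circle in the first link; colouring this circle alone separates `p`
        -- from `r`.
        · obtain ⟨h1, h2⟩ := h.joinPair_of_mate ha hc
          refine .inl ⟨?_, ?_, _, (isColoring_false w).cons (χ := fun j => j = i ∨ j = i + 1) ?_,
            ?_, ?_⟩
          · simp only [run, Layer.act, h1, loops_run_addLoop]
          · simp only [run, Layer.act, h2]
          · simp only [Layer.Compatible]
            have := raise_ne i
            grind
          · have := v1.mate_mate
            change S₁.Respects fun j => j = i ∨ j = i + 1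
            intro j
            grind
          · change ¬ ((p = i ∨ p = i + 1) ↔ (r = i ∨ r = i + 1))
            grind
        · obtain ⟨h1, h2⟩ := h.swap₁₂.joinPair_of_mate (by grind) hc
          refine .inr ⟨.inl ⟨?_, ?_⟩, hsame (by grind)⟩
          · simp only [run, Layer.act, h1, loops_run_addLoop]
          · simp only [run, Layer.act, h2]
        · obtain ⟨h1, h2⟩ := h.swap₂₃.swap₁₂.joinPair_of_mate (by grind) hc
          refine .inr ⟨.inr ⟨?_, ?_⟩, hsame (by grind)⟩
          · simp only [run, Layer.act, h1, loops_run_addLoop]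
          · simp only [run, Layer.act, h2]
      · refine (ih (h.joinPair hi' ha) hw').cons h.valid₁ hl fun χ χ' hr hc => ?_
        have key (j : ℕ) (hj : j ∈ [p, q, r, s]) : χ j ↔ χ' (lower i (S₁.follow i j)) := by
          obtain ⟨h1, h2⟩ := hc
          have e1 := h.valid₁.mate_mate
          have := h.valid₁.mate_ne (j := i) (by omega)
          have := h.valid₁.mate_ne (j := i + 1) (by omega)
          have hne : S₁.follow i j ≠ i ∧ S₁.follow i j ≠ i + 1 := by
            have := h.mate₁
            simp only [List.mem_cons, List.not_mem_nil, or_false] at hj ha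
            grind [State.follow]
          rw [← h2]
          simp only [raise_lower hne.1 hne.2] at h1 ⊢
          have := hr i
          have := hr (i + 1)
          grind [State.follow]
        exact ⟨key p (by simp), key r (by simp)⟩
    · rw [Nat.sub_add_cancel (by omega)] at hm
      subst hm
      exact (ih (h.exchangePair hi) hw').cons h.valid₁ hl
        fun χ χ' _ hc => ⟨(hc p).symm, (hc r).symm⟩

/-! ### Smoothing a crossing -/

/-- A crossing and its two smoothings form a rewiring, unless the arc below the crossing joins its
two lower ends. -/
theorem State.Valid.rewiring (h : S.Valid (n + 2)) (hi : i ≤ n) (hm : S.mate i ≠ i + 1) :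
    Rewiring (n + 2) (S.exchangePair i) ((S.joinPair i).addPair i) S
      i (S.mate (i + 1)) (i + 1) (S.mate i) := by
  have e1 := h.mate_mate
  have f1 := h.mate_ne (j := i) (by omega)
  have f2 := h.mate_ne (j := i + 1) (by omega)
  have v := h.joinPair hi
  have hout : ∀ j, j ≠ i → j ≠ i + 1 → ((S.joinPair i).addPair i).mate j = S.joined i j := by
    intro j h1 h2
    obtain ⟨a, b, -⟩ := h.joined hi h1 h2
    simp [State.addPair, h1, h2, State.joinPair_mate, raise_lower, a, b]
  have hin : ((S.joinPair i).addPair i).mate i = i + 1 ∧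
      ((S.joinPair i).addPair i).mate (i + 1) = i := by
    simp [State.addPair]
  refine ⟨?_, h.exchangePair (by omega), v.addPair hi, h, ?_, rfl, ?_, ?_, ?_, ?_⟩
  · simp only [List.mem_cons, List.nodup_cons, List.not_mem_nil, or_false, List.nodup_nil]
    grind
  · simp [State.addPair, State.joinPair, State.exchangePair, hm]
  · simp only [State.exchangePair, exchange]
    grind
  · refine ⟨hin.1, hin.2, ?_, ?_⟩
    · rw [hout] <;> grind [State.joined]
    · rw [hout] <;> grind [State.joined]
  · grind
  · intro j h1 h2 h3 h4
    rw [hout j h1 h3]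
    simp only [State.exchangePair, exchange, State.joined]
    grind

namespace LinkDiagram.Crossing

variable {D : LinkDiagram} (c : D.Crossing)

theorem sameComponent_iff_coloring :
    c.SameComponent ↔ ∀ g, IsColoring D.word g →
      (g (c.below.length + 1) c.pos ↔ g (c.below.length + 1) (c.pos + 1)) := by
  rw [SameComponent, connected_iff_coloring]
  refine forall₂_congr fun g hg => ?_
  rw [c.word_eq] at hg
  have h : ∀ j, _ := (isColoring_cons.1 hg.of_append).1
  have h1 := h c.pos
  have h2 := h (c.pos + 1)
  simp only [exchange, if_true, Nat.succ_ne_self, if_false] at h1 h2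
  grind

theorem exists_width_below : ∃ n, width c.below 0 = some (n + 2) ∧ c.pos ≤ n ∧
    width c.above (n + 2) = some 0 := by
  have h := D.closed
  rw [c.word_eq] at h
  obtain ⟨k, hk, h⟩ := width_append_eq_some.1 h
  obtain ⟨k', hk', h⟩ := width_cons.1 h
  obtain ⟨h1, rfl⟩ := Layer.apply_eq_some.1 hk'
  simp only [Piece.inputs, Piece.outputs] at h1 h
  refine ⟨k - 2, ?_, by omega, h⟩
  rw [hk, Nat.sub_add_cancel (by omega)]

/-- The state just below the crossing. -/
def stateBelow : State := run c.below .initial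

theorem componentCount_eq :
    D.componentCount = (run c.above (c.stateBelow.exchangePair c.pos)).loops := by
  rw [componentCount, c.word_eq, run_append]
  rfl

theorem componentCount_smoothVertical :
    c.smoothVertical.componentCount = (run c.above c.stateBelow).loops := by
  rw [componentCount, smoothVertical, run_append]
  rfl

theorem componentCount_smoothHorizontal : c.smoothHorizontal.componentCount =
    (run c.above ((c.stateBelow.joinPair c.pos).addPair c.pos)).loops := by
  rw [componentCount, smoothHorizontal, run_append]
  rfl

theorem componentCount_pos (c : D.Crossing) : 0 < D.componentCount := by
  obtain ⟨n, h1, h2, h3⟩ := c.exists_width_below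
  rw [c.componentCount_eq]
  have v : c.stateBelow.Valid (n + 2) := State.valid_initial.run h1
  have := loops_lt_run (v.exchangePair (i := c.pos) (by omega)) h3 (by omega)
  omega

theorem componentCount_smoothVertical_pos : 0 < c.smoothVertical.componentCount := by
  obtain ⟨n, h1, h2, h3⟩ := c.exists_width_below
  rw [c.componentCount_smoothVertical]
  have v : c.stateBelow.Valid (n + 2) := State.valid_initial.run h1
  have := loops_lt_run v h3 (by omega)
  omega

/-- Smoothing a crossing of two components merges them in both ways; smoothing a crossing of a
component with itself splits it in one way and keeps the number of components in the other. -/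
theorem componentCount_smooth :
    (c.SameComponent ∧
      (c.smoothVertical.componentCount = D.componentCount ∧
          c.smoothHorizontal.componentCount = D.componentCount + 1 ∨
        c.smoothHorizontal.componentCount = D.componentCount ∧
          c.smoothVertical.componentCount = D.componentCount + 1)) ∨
    (¬ c.SameComponent ∧ c.smoothVertical.componentCount + 1 = D.componentCount ∧
      c.smoothHorizontal.componentCount + 1 = D.componentCount) := by
  obtain ⟨n, h1, h2, h3⟩ := c.exists_width_below
  have v : c.stateBelow.Valid (n + 2) := State.valid_initial.run h1
  rw [c.componentCount_smoothVertical, c.componentCount_smoothHorizontal, c.componentCount_eq,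
    sameComponent_iff_coloring]
  have hl : Layer.apply ⟨.cross c.overStrand, c.pos⟩ (n + 2) = some (n + 2) := by
    rw [Layer.apply_eq_some]
    simp only [Piece.inputs, Piece.outputs]
    omega
  have hw : width (c.below ++ [⟨.cross c.overStrand, c.pos⟩]) 0 = some (n + 2) :=
    width_append_eq_some.2 ⟨n + 2, h1, width_cons.2 ⟨n + 2, hl, rfl⟩⟩
  have hrun : run (c.below ++ [⟨.cross c.overStrand, c.pos⟩]) .initial =
    c.stateBelow.exchangePair c.pos := run_append _ _ _
  have hlen : (c.below ++ [(⟨.cross c.overStrand, c.pos⟩ : Layer)]).length =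
      c.below.length + 1 := by
    simp
  have hword : D.word = (c.below ++ [⟨.cross c.overStrand, c.pos⟩]) ++ c.above := by
    simp [c.word_eq]
  have hresp (g : ℕ → ℕ → Prop) (hg : IsColoring D.word g) :
      (c.stateBelow.exchangePair c.pos).Respects (g (c.below.length + 1)) := by
    rw [hword] at hg
    rw [← hrun, ← hlen]
    exact hg.respects_run State.valid_initial hw fun _ => Iff.rfl
  -- If the two lower ends are joined below the crossing, the crossing acts trivially and
  -- its horizontal smoothing cuts off a circle.
  by_cases hm : c.stateBelow.mate c.pos = c.pos + 1
  · have e := v.mate_mate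
    have e1 : c.stateBelow.exchangePair c.pos = c.stateBelow := by
      ext j <;> simp only [State.exchangePair, exchange]
      grind
    have e2 : (c.stateBelow.joinPair c.pos).addPair c.pos = c.stateBelow.addLoop := by
      ext j
      · by_cases hj : j = c.pos ∨ j = c.pos + 1
        · simp only [State.addPair, State.addLoop]
          grind
        · push Not at hj
          obtain ⟨a, b, -⟩ := v.joined h2 hj.1 hj.2
          simp only [State.addPair, hj, if_false, State.joinPair_mate, raise_lower, a, b, Ne,
            not_false_eq_true, State.addLoop]
          grind [State.joined]
      · simp [State.addPair, State.joinPair, State.addLoop, hm]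
    refine .inl ⟨fun g hg => ?_, .inl ⟨by rw [e1], by rw [e1, e2, loops_run_addLoop]⟩⟩
    have := hresp g hg c.pos
    rw [e1, hm] at this
    exact this.symm
  · rcases (v.rewiring h2 hm).trichotomy h3 with ⟨t1, t2, g, hg, hr, hne⟩ | ⟨t1, t2⟩
    · refine .inr ⟨fun hs => hne ?_, by omega, by omega⟩
      rw [← hrun] at hr
      obtain ⟨g', h4, -, h5⟩ := hg.exists_append State.valid_initial hw hr
      rw [← hword] at h4
      have := hs g' h4
      rwa [← hlen, ← Nat.add_zero (List.length _), h5 0] at this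
    · refine .inl ⟨fun g hg => ?_, by omega⟩
      have := hresp g hg
      rw [hword] at hg
      have h6 := t2 _ hg.of_append
      rw [hlen] at h6
      exact h6 this

end LinkDiagram.Crossing

/-! ### Relations in `B₂` and the invariant -/

namespace B₂

theorem mk_eq_zero_of_relator {x : MvPolynomial Gen ℤ} (h : Relator x) :
    (Ideal.Quotient.mk (Ideal.span {p | Relator p})) x = 0 :=
  Ideal.Quotient.eq_zero_iff_mem.2 (Ideal.subset_span h)

theorem gen_v_add_one (n : ℕ+) : gen (.v (n + 1)) = (gen .a' + gen .b') * gen (.v n) := by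
  simpa [sub_eq_zero, gen] using mk_eq_zero_of_relator (.split n)

theorem gen_curl (n : ℕ+) : gen .a * gen (.v n) + gen .b * gen (.v (n + 1)) = gen (.v n) := by
  have := mk_eq_zero_of_relator (.curl n)
  simp only [map_sub, map_mul, map_one] at this
  simp only [gen]
  linear_combination -this

/-- The relation of a curl for the mirror image crossing; it follows from the given one because of
`(1 - a) a = (1 - b) b`. -/
theorem gen_curl_mirror (n : ℕ+) :
    gen .a * gen (.v (n + 1)) + gen .b * gen (.v n) = gen (.v n) := by
  have h := gen_curl n
  have hs := gen_v_add_one n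
  have h1 := mk_eq_zero_of_relator .a_b
  have h2 := mk_eq_zero_of_relator .a_a
  have h3 := mk_eq_zero_of_relator .b_b
  have h4 := mk_eq_zero_of_relator .a'_b
  have h5 := mk_eq_zero_of_relator .a_b'
  simp only [map_sub, map_mul, map_one] at h1 h2 h3 h4 h5
  simp only [gen] at *
  rw [hs] at h ⊢
  -- With `x = v n`, the two curl relations differ by `(a - b) (1 - a' - b') x`, which the relations
  -- between `a`, `a'`, `b`, `b'` turn into `(a - a² - b + b²) x = 0`.
  linear_combination h - (h1 + h2 - h3 + h4 - h5) * Ideal.Quotient.mk _ (MvPolynomial.X (.v n))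

/-- The value of the invariant on a link with `n` components.  The value at `0` is arbitrary: it is
taken only by the empty diagram, which has no crossing and is not a smoothing of any crossing. -/
noncomputable def value : ℕ → B₂
  | 0 => 0
  | n + 1 => gen (.v n.succPNat)

theorem value_pnat (n : ℕ+) : value n = gen (.v n) := by
  obtain ⟨k, rfl⟩ : ∃ k : ℕ, n = k.succPNat := ⟨n.natPred, by simp⟩
  rfl

theorem value_add_one {n : ℕ} (hn : 0 < n) : value (n + 1) = (gen .a' + gen .b') * value n := by
  lift n to ℕ+ using hn
  rw [value_pnat, ← gen_v_add_one, ← value_pnat]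
  rfl

theorem value_curl {n : ℕ} (hn : 0 < n) :
    gen .a * value n + gen .b * value (n + 1) = value n ∧
      gen .a * value (n + 1) + gen .b * value n = value n := by
  lift n to ℕ+ using hn
  have : value (n + 1) = gen (.v (n + 1)) := value_pnat (n + 1)
  rw [this, value_pnat]
  exact ⟨gen_curl n, gen_curl_mirror n⟩

end B₂

/-- The skein relations reduce to `v (n + 1) = (a' + b') v n` at a mixed crossing, and to the two
curl relations at a crossing of a component with itself. -/
theorem isSkeinInvariant_value : IsSkeinInvariant (B₂.gen .a) (B₂.gen .a') (B₂.gen .b) (B₂.gen .b')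
    (fun n => B₂.gen (.v n)) (fun D => B₂.value D.componentCount) where
  invariant D E h := by rw [h.componentCount_eq]
  skein_same D c hc := by
    have h1 := B₂.value_curl c.componentCount_pos
    rcases c.componentCount_smooth with ⟨-, ⟨h2, h3⟩ | ⟨h2, h3⟩⟩ | ⟨h, -⟩
    · unfold LinkDiagram.Crossing.smoothI LinkDiagram.Crossing.smoothII
      cases c.overStrand <;> simp only [h2, h3, h1]
    · unfold LinkDiagram.Crossing.smoothI LinkDiagram.Crossing.smoothII
      cases c.overStrand <;> simp only [h2, h3, h1]
    · exact absurd hc h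
  skein_mixed D c hc := by
    rcases c.componentCount_smooth with ⟨h, -⟩ | ⟨-, h2, h3⟩
    · exact absurd h hc
    · have h4 : c.smoothHorizontal.componentCount = c.smoothVertical.componentCount := by omega
      rw [← h2, B₂.value_add_one c.componentCount_smoothVertical_pos, add_mul]
      unfold LinkDiagram.Crossing.smoothI LinkDiagram.Crossing.smoothII
      cases c.overStrand <;> simp only [h4]
  trivial n D h := by
    rw [SameLink.componentCount_eq h, componentCount_circles, B₂.value_pnat]

theorem IsSkeinInvariant.map {R R' : Type*} [CommRing R] [CommRing R'] {a a' b b' : R} {v : ℕ+ → R}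
    {f : LinkDiagram → R} (h : IsSkeinInvariant a a' b b' v f) (φ : R →+* R') :
    IsSkeinInvariant (φ a) (φ a') (φ b) (φ b') (fun n => φ (v n)) (fun D => φ (f D)) where
  invariant D E hDE := congrArg φ (h.invariant D E hDE)
  skein_same D c hc := by rw [h.skein_same D c hc, map_add, map_mul, map_mul]
  skein_mixed D c hc := by rw [h.skein_mixed D c hc, map_add, map_mul, map_mul]
  trivial n D hD := congrArg φ (h.trivial n D hD)

end SkeinLink

theorem mainTheorem3 :
    ∃ f : SkeinLink.LinkDiagram → SkeinLink.B₂,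
      SkeinLink.IsSkeinInvariant (SkeinLink.B₂.gen .a) (SkeinLink.B₂.gen .a')
        (SkeinLink.B₂.gen .b) (SkeinLink.B₂.gen .b') (fun n => SkeinLink.B₂.gen (.v n)) f ∧
      ∀ (R : Type*) [CommRing R] (φ : SkeinLink.B₂ →+* R),
        SkeinLink.IsSkeinInvariant (φ (SkeinLink.B₂.gen .a)) (φ (SkeinLink.B₂.gen .a'))
          (φ (SkeinLink.B₂.gen .b)) (φ (SkeinLink.B₂.gen .b'))
          (fun n => φ (SkeinLink.B₂.gen (.v n))) (fun D => φ (f D)) :=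
  ⟨_, SkeinLink.isSkeinInvariant_value, fun _ _ φ => SkeinLink.isSkeinInvariant_value.map φ⟩
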